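/- For a finite poset $P$ let $\mathcal{K}(P)$ denote its order complex, i.e. the simplicial complex whose vertices are the elements of $P$ and whose simplices are the non-empty chains of $P$. An order-preserving map $f : X \to Y$ between finite posets induces a simplicial map $\mathcal{K}(f) : \mathcal{K}(X) \to \mathcal{K}(Y)$ that coincides with $f$ on vertices. A simplicial complex is called acyclic if it is non-empty and all its reduced integral homology groups vanish. Let $f : X \to Y$ be an order-preserving map between two finite posets. For $y \in Y$ put $U_y = \{y' \in Y : y' \le y\}$, and regard $f^{-1}(U_y) \subseteq X$ as a poset with the order induced from $X$. If $\mathcal{K}(f^{-1}(U_y))$ is acyclic for every $y \in Y$, then for every $n \ge 0$ the induced homomorphism $$\mathcal{K}(f)_* : H_n(\mathcal{K}(X);\mathbb{Z}) \to H_n(\mathcal{K}(Y);\mathbb{Z})$$ is an isomorphism. -/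

import Mathlib

namespace AbstractSimplicialComplex

/-- The order complex of a poset: its vertices are the elements of the poset and its simplices are
the non-empty finite chains. -/
def orderComplex (X : Type*) [PartialOrder X] : AbstractSimplicialComplex X where
  faces := {s | s.Nonempty ∧ IsChain (· ≤ ·) (s : Set X)}
  isRelLowerSet_faces := fun _ hs =>
    ⟨hs.1, fun _ hts ht => ⟨ht, hs.2.mono (Finset.coe_subset.mpr hts)⟩⟩
  singleton_mem v := ⟨Finset.singleton_nonempty v, by simp⟩

open Classical in
/-- A simplicial map: a map on vertices that sends simplices to simplices. -/
structure SimplicialMap {V W : Type*} (K : AbstractSimplicialComplex V)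
    (L : AbstractSimplicialComplex W) where
  /-- the map on vertices -/
  toFun : V → W
  /-- the image of a simplex is a simplex -/
  image_mem : ∀ s : Finset V, s ∈ K → s.image toFun ∈ L

/-- The simplicial map of order complexes that coincides with a given order-preserving map on
vertices. -/
def orderComplexMap {X Y : Type*} [PartialOrder X] [PartialOrder Y] (f : X →o Y) :
    SimplicialMap (orderComplex X) (orderComplex Y) where
  toFun := f
  image_mem := by
    classical
    rintro s ⟨hne, hc⟩
    refine ⟨hne.image _, ?_⟩
    rw [Finset.coe_image]
    exact hc.image_of_map_rel _ _ f fun _ _ h => f.monotone h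

/-! ### Simplicial homology with integer coefficients

It is computed by the ordered simplicial chains: the chain group in degree `n` is free abelian on
the `(n + 1)`-tuples of vertices, repetitions allowed, whose entries span a simplex. -/

open Classical in
/-- An ordered `n`-simplex `(v 0, …, v n)`: the set of its entries is a simplex of `K`. -/
def OrderedSimplex {V : Type*} (K : AbstractSimplicialComplex V) (n : ℕ) : Type _ :=
  {v : Fin (n + 1) → V // Finset.univ.image v ∈ K}

/-- The group of integral `n`-chains. -/
abbrev Chains {V : Type*} (K : AbstractSimplicialComplex V) (n : ℕ) : Type _ :=
  OrderedSimplex K n →₀ ℤ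

/-- The `i`-th face of an ordered simplex, obtained by omitting the `i`-th entry. -/
def OrderedSimplex.face {V : Type*} {K : AbstractSimplicialComplex V} {n : ℕ}
    (s : OrderedSimplex K (n + 1)) (i : Fin (n + 2)) : OrderedSimplex K n :=
  ⟨s.1 ∘ i.succAbove, by
    classical
    refine (K.isRelLowerSet_faces s.2).2 ?_ (Finset.univ_nonempty.image _)
    intro x hx
    simp only [Finset.mem_image, Finset.mem_univ, true_and, Function.comp_apply] at hx ⊢
    obtain ⟨j, rfl⟩ := hx
    exact ⟨_, rfl⟩⟩

/-- The image of an ordered simplex under a simplicial map. -/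
def OrderedSimplex.map {V W : Type*} {K : AbstractSimplicialComplex V}
    {L : AbstractSimplicialComplex W} (φ : SimplicialMap K L) {n : ℕ} (s : OrderedSimplex K n) :
    OrderedSimplex L n :=
  ⟨φ.toFun ∘ s.1, by
    classical
    have h := φ.image_mem _ s.2
    rw [Finset.image_image] at h
    convert h⟩

/-- The boundary `∂ (v 0, …, v (n+1)) = ∑ i, (-1)^i (v 0, …, omit v i, …, v (n+1))`. -/
noncomputable def boundary {V : Type*} (K : AbstractSimplicialComplex V) (n : ℕ) :
    Chains K (n + 1) →ₗ[ℤ] Chains K n :=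
  Finsupp.linearCombination ℤ fun s : OrderedSimplex K (n + 1) =>
    ∑ i : Fin (n + 2), (-1 : ℤ) ^ (i : ℕ) • Finsupp.single (s.face i) (1 : ℤ)

/-- The augmentation, which sends every `0`-simplex to `1`. -/
noncomputable def augmentation {V : Type*} (K : AbstractSimplicialComplex V) :
    Chains K 0 →ₗ[ℤ] ℤ :=
  Finsupp.linearCombination ℤ fun _ : OrderedSimplex K 0 => (1 : ℤ)

/-- The chain map induced by a simplicial map. -/
noncomputable def chainMap {V W : Type*} {K : AbstractSimplicialComplex V}
    {L : AbstractSimplicialComplex W} (φ : SimplicialMap K L) (n : ℕ) :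
    Chains K n →ₗ[ℤ] Chains L n :=
  Finsupp.lmapDomain ℤ ℤ (OrderedSimplex.map φ)

theorem boundary_single {V : Type*} (K : AbstractSimplicialComplex V) (n : ℕ)
    (s : OrderedSimplex K (n + 1)) :
    boundary K n (Finsupp.single s 1) =
      ∑ i : Fin (n + 2), (-1 : ℤ) ^ (i : ℕ) • Finsupp.single (s.face i) (1 : ℤ) := by
  simp [boundary]

theorem boundary_chainMap {V W : Type*} {K : AbstractSimplicialComplex V}
    {L : AbstractSimplicialComplex W} (φ : SimplicialMap K L) (n : ℕ) (c : Chains K (n + 1)) :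
    boundary L n (chainMap φ (n + 1) c) = chainMap φ n (boundary K n c) := by
  suffices h : boundary L n ∘ₗ chainMap φ (n + 1) = chainMap φ n ∘ₗ boundary K n from
    LinearMap.congr_fun h c
  refine Finsupp.lhom_ext' fun s => LinearMap.ext_ring ?_
  simp only [LinearMap.comp_apply, Finsupp.lsingle_apply, boundary_single, map_sum, map_smul]
  simp only [chainMap, Finsupp.lmapDomain_apply, Finsupp.mapDomain_single, boundary_single]
  rfl

theorem augmentation_boundary {V : Type*} (K : AbstractSimplicialComplex V) (c : Chains K 1) :
    augmentation K (boundary K 0 c) = 0 := by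
  suffices h : augmentation K ∘ₗ boundary K 0 = 0 from LinearMap.congr_fun h c
  refine Finsupp.lhom_ext' fun s => LinearMap.ext_ring ?_
  simp [boundary_single, augmentation, Fin.sum_univ_two]

theorem boundary_boundary {V : Type*} (K : AbstractSimplicialComplex V) (n : ℕ)
    (c : Chains K (n + 2)) : boundary K n (boundary K (n + 1) c) = 0 := by
  suffices h : boundary K n ∘ₗ boundary K (n + 1) = 0 from LinearMap.congr_fun h c
  refine Finsupp.lhom_ext' fun s => LinearMap.ext_ring ?_
  simp only [LinearMap.comp_apply, Finsupp.lsingle_apply, boundary_single, map_sum, map_smul,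
    LinearMap.zero_apply, Finset.smul_sum, smul_smul, ← pow_add]
  rw [← Finset.sum_product']
  refine Finset.sum_involution (fun p _ => (p.1.succAbove p.2, p.2.predAbove p.1)) ?_ ?_ ?_ ?_
  · rintro ⟨i, j⟩ -
    have h : (s.face (i.succAbove j)).face (j.predAbove i) = (s.face i).face j :=
      Subtype.ext (funext fun k =>
        congrArg s.1 (Fin.succAbove_succAbove_succAbove_predAbove i j k))
    simp only [h, Fin.neg_one_pow_succAbove_add_predAbove, neg_smul, add_neg_cancel]
  · rintro ⟨i, j⟩ - - h
    exact Fin.succAbove_ne i j (congrArg Prod.fst h)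
  · exact fun _ _ => Finset.mem_product.mpr ⟨Finset.mem_univ _, Finset.mem_univ _⟩
  · rintro ⟨i, j⟩ -
    exact Prod.ext (Fin.succAbove_succAbove_predAbove i j) (Fin.predAbove_predAbove_succAbove i j)

/-- The cycles: all chains in degree `0`, the kernel of the boundary in positive degrees. -/
noncomputable def cycles {V : Type*} (K : AbstractSimplicialComplex V) :
    (n : ℕ) → Submodule ℤ (Chains K n)
  | 0 => ⊤
  | n + 1 => LinearMap.ker (boundary K n)

/-- The cycles of the augmented chain complex in non-negative degrees. -/
noncomputable def reducedCycles {V : Type*} (K : AbstractSimplicialComplex V) :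
    (n : ℕ) → Submodule ℤ (Chains K n)
  | 0 => LinearMap.ker (augmentation K)
  | n + 1 => LinearMap.ker (boundary K n)

/-- The integral homology group `H_n(K)`: cycles modulo boundaries. -/
abbrev Homology {V : Type*} (K : AbstractSimplicialComplex V) (n : ℕ) : Type _ :=
  cycles K n ⧸ (LinearMap.range (boundary K n)).submoduleOf (cycles K n)

/-- The reduced integral homology group in a non-negative degree `n`. -/
abbrev ReducedHomology {V : Type*} (K : AbstractSimplicialComplex V) (n : ℕ) : Type _ :=
  reducedCycles K n ⧸ (LinearMap.range (boundary K n)).submoduleOf (reducedCycles K n)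

/-- A complex is acyclic if it is non-empty and all its reduced integral homology groups vanish.
(Non-emptiness is the vanishing of reduced homology in degree `-1`.) -/
def IsAcyclic {V : Type*} (K : AbstractSimplicialComplex V) : Prop :=
  Nonempty V ∧ ∀ n : ℕ, Subsingleton (ReducedHomology K n)

theorem chainMap_mem_cycles {V W : Type*} {K : AbstractSimplicialComplex V}
    {L : AbstractSimplicialComplex W} (φ : SimplicialMap K L) (n : ℕ) :
    ∀ c ∈ cycles K n, chainMap φ n c ∈ cycles L n := by
  cases n with
  | zero => exact fun _ _ => Submodule.mem_top
  | succ n =>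
    intro c hc
    have hc' : boundary K n c = 0 := hc
    change boundary L n _ = 0
    rw [boundary_chainMap, hc', map_zero]

/-- The map in homology induced by a simplicial map. -/
noncomputable def homologyMap {V W : Type*} {K : AbstractSimplicialComplex V}
    {L : AbstractSimplicialComplex W} (φ : SimplicialMap K L) (n : ℕ) :
    Homology K n →ₗ[ℤ] Homology L n :=
  Submodule.mapQ _ _ ((chainMap φ n).restrict (chainMap_mem_cycles φ n)) (by
    rintro ⟨c, hc⟩ ⟨b, hb⟩
    refine ⟨chainMap φ (n + 1) b, ?_⟩
    rw [boundary_chainMap, hb]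
    rfl)

end AbstractSimplicialComplex

/-! The proof is by acyclic carriers. A simplex of `orderComplex Y` is a finite chain with a
greatest entry `y`, so the lower closure of its vertex set is `Set.Iic y`, and the preimage of this
under `f` is acyclic by hypothesis. Hence `S ↦ f ⁻¹' lowerClosure S` carries a chain map `g` from
chains of `Y` to chains of `X` (`exists_carried_chainMap`). By `sub_mem_range_boundary_of_carried`,
chain maps with a common acyclic carrier agree in homology. On `X`, both `g ∘ f` and the identity
are carried by `S ↦ f ⁻¹' lowerClosure (f '' S)`; on `Y`, both `f ∘ g` and the identity are carried
by the lower closure, acyclic because `Set.Iic y` is a cone with apex `y`. So `g` inverts `f` in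
homology. -/

namespace AbstractSimplicialComplex

/-! ### Acyclic carriers on ordered simplicial chains -/

section Carriers

variable {U V W : Type*} {J : AbstractSimplicialComplex U} {K : AbstractSimplicialComplex V}
  {L : AbstractSimplicialComplex W}

/-- The chains of `K` all of whose simplices have their vertices in `A`. -/
noncomputable def chainsIn (K : AbstractSimplicialComplex V) (A : Set V) (n : ℕ) :
    Submodule ℤ (Chains K n) :=
  Finsupp.supported ℤ ℤ {s | Set.range s.1 ⊆ A}

theorem single_mem_chainsIn {A : Set V} {n : ℕ} {s : OrderedSimplex K n}
    (hs : Set.range s.1 ⊆ A) (a : ℤ) : Finsupp.single s a ∈ chainsIn K A n :=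
  Finsupp.single_mem_supported ℤ a hs

theorem chainsIn_mono {A B : Set V} (h : A ⊆ B) (n : ℕ) : chainsIn K A n ≤ chainsIn K B n :=
  Finsupp.supported_mono fun _ hs => Set.Subset.trans hs h

theorem chainsIn_le_comap {A : Set V} {n : ℕ} {M : Type*} [AddCommGroup M]
    (T : Chains K n →ₗ[ℤ] M) (N : Submodule ℤ M)
    (h : ∀ s : OrderedSimplex K n, Set.range s.1 ⊆ A → T (Finsupp.single s 1) ∈ N) :
    chainsIn K A n ≤ N.comap T := by
  rw [chainsIn, Finsupp.supported_eq_span_single, Submodule.span_le]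
  rintro _ ⟨s, hs, rfl⟩
  exact h s hs

theorem range_face_subset {n : ℕ} (s : OrderedSimplex K (n + 1)) (i : Fin (n + 2)) :
    Set.range (s.face i).1 ⊆ Set.range s.1 := by
  rintro _ ⟨j, rfl⟩
  exact ⟨_, rfl⟩

theorem boundary_single_mem_chainsIn {n : ℕ} (s : OrderedSimplex K (n + 1)) :
    boundary K n (Finsupp.single s 1) ∈ chainsIn K (Set.range s.1) n := by
  rw [boundary_single]
  exact Submodule.sum_mem _ fun i _ =>
    Submodule.smul_mem _ _ (single_mem_chainsIn (range_face_subset s i) 1)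

theorem boundary_mem_reducedCycles (n : ℕ) (c : Chains K (n + 1)) :
    boundary K n c ∈ reducedCycles K n := by
  cases n with
  | zero => exact augmentation_boundary K c
  | succ n => exact boundary_boundary K n c

theorem boundary_mem_cycles (n : ℕ) (c : Chains K (n + 1)) :
    boundary K n c ∈ cycles K n := by
  cases n with
  | zero => exact Submodule.mem_top
  | succ n => exact boundary_boundary K n c

/-- The full subcomplex of `K` on the vertex set `A` is acyclic, expressed by chains of `K`. -/
structure AcyclicOn (K : AbstractSimplicialComplex V) (A : Set V) : Prop where
  exists_augmentation_eq_one : ∃ a ∈ chainsIn K A 0, augmentation K a = 1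
  exists_boundary_eq : ∀ n, ∀ c ∈ chainsIn K A n, c ∈ reducedCycles K n →
    ∃ b ∈ chainsIn K A (n + 1), boundary K n b = c

/-- A linear map of chain groups is carried by `Φ` if it sends each ordered simplex `s` to a chain
with vertices in `Φ s`. -/
def Carried (Φ : Set V → Set W) {n m : ℕ} (T : Chains K n →ₗ[ℤ] Chains L m) : Prop :=
  ∀ s : OrderedSimplex K n, T (Finsupp.single s 1) ∈ chainsIn L (Φ (Set.range s.1)) m

theorem Carried.mem {Φ : Set V → Set W} (hΦ : Monotone Φ) {n m : ℕ}
    {T : Chains K n →ₗ[ℤ] Chains L m} (hT : Carried Φ T) {A : Set V} {c : Chains K n}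
    (hc : c ∈ chainsIn K A n) : T c ∈ chainsIn L (Φ A) m :=
  chainsIn_le_comap T _ (fun s hs => chainsIn_mono (hΦ hs) m (hT s)) hc

theorem Carried.comp {Φ : Set U → Set V} {Ψ : Set V → Set W} (hΨ : Monotone Ψ) {n m k : ℕ}
    {T : Chains K m →ₗ[ℤ] Chains L k} {S : Chains J n →ₗ[ℤ] Chains K m}
    (hT : Carried Ψ T) (hS : Carried Φ S) : Carried (Ψ ∘ Φ) (T ∘ₗ S) :=
  fun s => hT.mem hΨ (hS s)

theorem Carried.mono {Φ Ψ : Set V → Set W} (h : ∀ A, Φ A ⊆ Ψ A) {n m : ℕ}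
    {T : Chains K n →ₗ[ℤ] Chains L m} (hT : Carried Φ T) : Carried Ψ T :=
  fun s => chainsIn_mono (h _) m (hT s)

theorem Carried.sub {Φ : Set V → Set W} {n m : ℕ} {S T : Chains K n →ₗ[ℤ] Chains L m}
    (hS : Carried Φ S) (hT : Carried Φ T) : Carried Φ (S - T) :=
  fun s => Submodule.sub_mem _ (hS s) (hT s)

theorem Carried.comp_boundary {Φ : Set V → Set W} (hΦ : Monotone Φ) {n m : ℕ}
    {T : Chains K n →ₗ[ℤ] Chains L m} (hT : Carried Φ T) : Carried Φ (T ∘ₗ boundary K n) :=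
  fun s => hT.mem hΦ (boundary_single_mem_chainsIn s)

theorem carried_id {Φ : Set V → Set V} (h : ∀ A, A ⊆ Φ A) (n : ℕ) :
    Carried Φ (LinearMap.id : Chains K n →ₗ[ℤ] Chains K n) :=
  fun _ => single_mem_chainsIn (h _) 1

theorem chainMap_single (φ : SimplicialMap K L) {n : ℕ} (s : OrderedSimplex K n) (a : ℤ) :
    chainMap φ n (Finsupp.single s a) = Finsupp.single (s.map φ) a :=
  Finsupp.mapDomain_single

theorem range_map (φ : SimplicialMap K L) {n : ℕ} (s : OrderedSimplex K n) :
    Set.range (s.map φ).1 = φ.toFun '' Set.range s.1 :=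
  Set.range_comp φ.toFun s.1

theorem carried_chainMap (φ : SimplicialMap K L) (n : ℕ) :
    Carried (Set.image φ.toFun) (chainMap φ n) := fun s => by
  rw [chainMap_single]
  exact single_mem_chainsIn (range_map φ s).subset 1

theorem augmentation_chainMap (φ : SimplicialMap K L) (c : Chains K 0) :
    augmentation L (chainMap φ 0 c) = augmentation K c := by
  suffices h : augmentation L ∘ₗ chainMap φ 0 = augmentation K from LinearMap.congr_fun h c
  refine Finsupp.lhom_ext' fun s => LinearMap.ext_ring ?_
  simp [chainMap_single, augmentation]

/-- Chains are free on ordered simplices, so a filling can be chosen for each simplex inside its own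
carrier and extended linearly. This is the inductive step for both chain maps and homotopies. -/
theorem Carried.exists_lift {Φ : Set V → Set W} {n m : ℕ}
    (hΦ : ∀ s : OrderedSimplex K n, AcyclicOn L (Φ (Set.range s.1)))
    {T : Chains K n →ₗ[ℤ] Chains L m} (hT : Carried Φ T)
    (hcycle : ∀ c, T c ∈ reducedCycles L m) :
    ∃ D : Chains K n →ₗ[ℤ] Chains L (m + 1), Carried Φ D ∧ ∀ c, boundary L m (D c) = T c := by
  choose b hb hbT using fun s => (hΦ s).exists_boundary_eq m _ (hT s) (hcycle _)
  refine ⟨Finsupp.linearCombination ℤ b, fun s => ?_, fun c => ?_⟩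
  · simpa using hb s
  · suffices h : boundary L m ∘ₗ Finsupp.linearCombination ℤ b = T from LinearMap.congr_fun h c
    refine Finsupp.lhom_ext' fun s => LinearMap.ext_ring ?_
    simp [hbT]

/-- An acyclic carrier carries an augmentation-preserving chain map. -/
theorem exists_carried_chainMap {Φ : Set V → Set W} (hmono : Monotone Φ)
    (hΦ : ∀ (n : ℕ) (s : OrderedSimplex K n), AcyclicOn L (Φ (Set.range s.1))) :
    ∃ g : ∀ n, Chains K n →ₗ[ℤ] Chains L n, (∀ n, Carried Φ (g n)) ∧
      (∀ c, augmentation L (g 0 c) = augmentation K c) ∧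
      ∀ n c, boundary L n (g (n + 1) c) = g n (boundary K n c) := by
  -- Preserving reduced cycles is the part of being a chain map that the next degree needs: it makes
  -- `T ∘ ∂` cycle-valued, hence liftable.
  let Good (n : ℕ) (T : Chains K n →ₗ[ℤ] Chains L n) : Prop :=
    Carried Φ T ∧ ∀ c ∈ reducedCycles K n, T c ∈ reducedCycles L n
  have start : ∃ T : Chains K 0 →ₗ[ℤ] Chains L 0, Good 0 T ∧
      ∀ c, augmentation L (T c) = augmentation K c := by
    choose a ha ha1 using fun s => (hΦ 0 s).exists_augmentation_eq_one
    have haug : ∀ c, augmentation L (Finsupp.linearCombination ℤ a c) = augmentation K c := by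
      intro c
      suffices h : augmentation L ∘ₗ Finsupp.linearCombination ℤ a = augmentation K from
        LinearMap.congr_fun h c
      refine Finsupp.lhom_ext' fun s => LinearMap.ext_ring ?_
      simpa [augmentation] using ha1 s
    refine ⟨Finsupp.linearCombination ℤ a, ⟨fun s => by simpa using ha s, fun c hc => ?_⟩, haug⟩
    exact (haug c).trans hc
  have step : ∀ n (T : {T // Good n T}), ∃ T' : {T' // Good (n + 1) T'},
      ∀ c, boundary L n (T'.1 c) = T.1 (boundary K n c) := by
    rintro n ⟨T, hT, hcycle⟩
    obtain ⟨D, hD, hDT⟩ := (hT.comp_boundary hmono).exists_lift (hΦ (n + 1))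
      fun c => hcycle _ (boundary_mem_reducedCycles n c)
    refine ⟨⟨D, hD, fun c hc => ?_⟩, hDT⟩
    have hc' : boundary K n c = 0 := hc
    change boundary L n (D c) = 0
    rw [hDT, LinearMap.comp_apply, hc', map_zero]
  obtain ⟨T₀, hT₀, haug⟩ := start
  choose next hnext using step
  let g (n : ℕ) : {T // Good n T} := Nat.rec ⟨T₀, hT₀⟩ next n
  exact ⟨fun n => (g n).1, fun n => (g n).2.1, haug, fun n => hnext n (g n)⟩

/-- Two augmentation-preserving chain maps with a common acyclic carrier agree in homology. -/
theorem sub_mem_range_boundary_of_carried {Φ : Set V → Set W} (hmono : Monotone Φ)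
    (hΦ : ∀ (n : ℕ) (s : OrderedSimplex K n), AcyclicOn L (Φ (Set.range s.1)))
    {g h : ∀ n, Chains K n →ₗ[ℤ] Chains L n}
    (hg : ∀ n, Carried Φ (g n)) (hh : ∀ n, Carried Φ (h n))
    (hg₀ : ∀ c, augmentation L (g 0 c) = augmentation K c)
    (hh₀ : ∀ c, augmentation L (h 0 c) = augmentation K c)
    (hg₁ : ∀ n c, boundary L n (g (n + 1) c) = g n (boundary K n c))
    (hh₁ : ∀ n c, boundary L n (h (n + 1) c) = h n (boundary K n c))
    (n : ℕ) (c : Chains K n) (hc : c ∈ cycles K n) :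
    g n c - h n c ∈ LinearMap.range (boundary L n) := by
  -- The homotopy formula is required only on cycles, where its term `D ∘ ∂` vanishes, so degree `0`
  -- has the same form as the others. This suffices for the induction, since it is applied to
  -- boundaries.
  suffices H : ∀ n, ∃ D : Chains K n →ₗ[ℤ] Chains L (n + 1), Carried Φ D ∧
      ∀ c ∈ cycles K n, boundary L n (D c) = g n c - h n c by
    obtain ⟨D, -, hD⟩ := H n
    exact ⟨D c, hD c hc⟩
  clear hc c n
  intro n
  induction n with
  | zero =>
    obtain ⟨D, hD, hDT⟩ := ((hg 0).sub (hh 0)).exists_lift (hΦ 0) fun c => by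
      change augmentation L (g 0 c - h 0 c) = 0
      rw [map_sub, hg₀, hh₀, sub_self]
    exact ⟨D, hD, fun c _ => hDT c⟩
  | succ n ih =>
    obtain ⟨D, hD, hDT⟩ := ih
    obtain ⟨E, hE, hET⟩ := (((hg (n + 1)).sub (hh (n + 1))).sub
      (hD.comp_boundary hmono)).exists_lift (hΦ (n + 1)) fun c => by
        change boundary L n (g (n + 1) c - h (n + 1) c - D (boundary K n c)) = 0
        rw [map_sub, map_sub, hg₁, hh₁, hDT _ (boundary_mem_cycles n c), sub_self]
    refine ⟨E, hE, fun c hc => ?_⟩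
    have hc' : boundary K n c = 0 := hc
    rw [hET]
    simp [hc']

theorem homologyMap_bijective_of_inverse (φ : SimplicialMap K L)
    (g : ∀ n, Chains L n →ₗ[ℤ] Chains K n)
    (hg : ∀ n c, boundary K n (g (n + 1) c) = g n (boundary L n c))
    (hK : ∀ n, ∀ c ∈ cycles K n, g n (chainMap φ n c) - c ∈ LinearMap.range (boundary K n))
    (hL : ∀ n, ∀ c ∈ cycles L n, chainMap φ n (g n c) - c ∈ LinearMap.range (boundary L n))
    (n : ℕ) : Function.Bijective (homologyMap φ n) := by
  constructor
  · rw [injective_iff_map_eq_zero]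
    intro x hx
    obtain ⟨⟨c, hc⟩, rfl⟩ := Submodule.Quotient.mk_surjective _ x
    obtain ⟨b, hb⟩ : chainMap φ n c ∈ LinearMap.range (boundary L n) :=
      (Submodule.Quotient.mk_eq_zero ((LinearMap.range (boundary L n)).submoduleOf _)).mp hx
    refine (Submodule.Quotient.mk_eq_zero _).mpr ?_
    change c ∈ LinearMap.range (boundary K n)
    -- Both terms are boundaries: `g (φ c)` because `φ c` is one, and the difference by `hK`.
    rw [← sub_sub_cancel (g n (chainMap φ n c)) c]
    refine Submodule.sub_mem _ ⟨g (n + 1) b, ?_⟩ (hK n c hc)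
    rw [hg, hb]
  · intro y
    obtain ⟨⟨c, hc⟩, rfl⟩ := Submodule.Quotient.mk_surjective _ y
    have hgc : g n c ∈ cycles K n := by
      cases n with
      | zero => exact Submodule.mem_top
      | succ n =>
        have hc' : boundary L n c = 0 := hc
        change boundary K n _ = 0
        rw [hg, hc', map_zero]
    exact ⟨Submodule.Quotient.mk ⟨g n c, hgc⟩, (Submodule.Quotient.eq _).mpr (hL n c hc)⟩

end Carriers

/-! ### Order complexes: cones and full subcomplexes -/

section OrderComplex

variable {X Y : Type*} [PartialOrder X] [PartialOrder Y]

open Classical in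
theorem mem_orderComplex_of_range_subset {n : ℕ} {v : Fin (n + 1) → X} {t : Set X}
    (ht : IsChain (· ≤ ·) t) (hv : Set.range v ⊆ t) :
    Finset.univ.image v ∈ orderComplex X :=
  ⟨Finset.univ_nonempty.image _, ht.mono (by simpa using hv)⟩

/-- A vertex as an ordered simplex. -/
def vertex (x : X) : OrderedSimplex (orderComplex X) 0 :=
  ⟨fun _ => x, mem_orderComplex_of_range_subset (t := {x}) Set.subsingleton_singleton.isChain
    (by rintro _ ⟨_, rfl⟩; rfl)⟩

theorem OrderedSimplex.isChain {n : ℕ} (s : OrderedSimplex (orderComplex X) n) :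
    IsChain (· ≤ ·) (Set.range s.1) := by
  classical
  have h := s.2.2
  simpa using h

theorem OrderedSimplex.exists_isGreatest {n : ℕ} (s : OrderedSimplex (orderComplex X) n) :
    ∃ x, IsGreatest (Set.range s.1) x := by
  obtain ⟨x, hx⟩ := (Set.finite_range s.1).exists_maximal (Set.range_nonempty s.1)
  exact ⟨x, hx.prop, fun y hy => (s.isChain.total hy hx.prop).elim id (hx.le_of_ge hy)⟩

/-- The join of an ordered simplex with the greatest element. -/
def OrderedSimplex.consTop [OrderTop X] {n : ℕ} (s : OrderedSimplex (orderComplex X) n) :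
    OrderedSimplex (orderComplex X) (n + 1) :=
  ⟨Fin.cons ⊤ s.1,
    mem_orderComplex_of_range_subset (s.isChain.insert (a := ⊤) fun _ _ _ => Or.inr le_top)
      (Fin.range_cons (⊤ : X) s.1).subset⟩

theorem OrderedSimplex.consTop_face_zero [OrderTop X] {n : ℕ}
    (s : OrderedSimplex (orderComplex X) n) : s.consTop.face 0 = s :=
  Subtype.ext (funext fun j => by simp [face, consTop])

theorem OrderedSimplex.consTop_face_succ [OrderTop X] {n : ℕ}
    (s : OrderedSimplex (orderComplex X) (n + 1)) (i : Fin (n + 2)) :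
    s.consTop.face i.succ = (s.face i).consTop :=
  Subtype.ext (funext fun j => by
    refine Fin.cases ?_ (fun j => ?_) j <;> simp [face, consTop, Fin.removeNth])

/-- The cone operator on chains of the order complex of a poset with a greatest element. -/
noncomputable def cone (X : Type*) [PartialOrder X] [OrderTop X] (n : ℕ) :
    Chains (orderComplex X) n →ₗ[ℤ] Chains (orderComplex X) (n + 1) :=
  Finsupp.lmapDomain ℤ ℤ OrderedSimplex.consTop

theorem cone_single [OrderTop X] {n : ℕ} (s : OrderedSimplex (orderComplex X) n) (a : ℤ) :
    cone X n (Finsupp.single s a) = Finsupp.single s.consTop a :=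
  Finsupp.mapDomain_single

/-- Omitting the apex returns the simplex; every other face is the cone on a face, with its sign
shifted by one. Since repeated entries are allowed, simplices already containing `⊤` need no
separate treatment. -/
theorem boundary_cone_succ [OrderTop X] (n : ℕ) (c : Chains (orderComplex X) (n + 1)) :
    boundary _ (n + 1) (cone X (n + 1) c) = c - cone X n (boundary _ n c) := by
  suffices h : boundary _ (n + 1) ∘ₗ cone X (n + 1) = LinearMap.id - cone X n ∘ₗ boundary _ n from
    LinearMap.congr_fun h c
  refine Finsupp.lhom_ext' fun s => LinearMap.ext_ring ?_
  simp only [LinearMap.comp_apply, Finsupp.lsingle_apply, cone_single, boundary_single,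
    LinearMap.sub_apply, LinearMap.id_apply, map_sum, map_smul]
  rw [Fin.sum_univ_succ]
  simp [OrderedSimplex.consTop_face_zero, OrderedSimplex.consTop_face_succ, pow_succ,
    sub_eq_add_neg]

theorem boundary_cone_zero [OrderTop X] (c : Chains (orderComplex X) 0)
    (hc : augmentation _ c = 0) : boundary _ 0 (cone X 0 c) = c := by
  let t : OrderedSimplex (orderComplex X) 0 := vertex ⊤
  -- In degree `0`, omitting the old vertex leaves the apex, so the correction is the augmentation
  -- times `⊤`.
  suffices h : boundary _ 0 ∘ₗ cone X 0 =
      LinearMap.id - (LinearMap.toSpanSingleton ℤ _ (Finsupp.single t 1)) ∘ₗ augmentation _ by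
    have h' := LinearMap.congr_fun h c
    simpa [hc] using h'
  refine Finsupp.lhom_ext' fun s => LinearMap.ext_ring ?_
  have ht : s.consTop.face 1 = t := Subtype.ext (funext fun j => by
    rw [Fin.fin_one_eq_zero j]
    simp [OrderedSimplex.face, OrderedSimplex.consTop, t, vertex])
  simp [cone_single, boundary_single, Fin.sum_univ_two, OrderedSimplex.consTop_face_zero, ht,
    augmentation, sub_eq_add_neg]

theorem isAcyclic_orderComplex_of_orderTop (X : Type*) [PartialOrder X] [OrderTop X] :
    (orderComplex X).IsAcyclic := by
  refine ⟨⟨⊤⟩, fun n => Submodule.Quotient.subsingleton_iff.mpr ?_⟩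
  refine Submodule.submoduleOf_eq_top.mpr fun c hc => ⟨cone X n c, ?_⟩
  cases n with
  | zero => exact boundary_cone_zero c hc
  | succ n =>
    have hc' : boundary _ n c = 0 := hc
    rw [boundary_cone_succ, hc', map_zero, sub_zero]

/-- The inclusion of the order complex of a subset. -/
def inclusion (A : Set X) : SimplicialMap (orderComplex A) (orderComplex X) :=
  orderComplexMap (OrderHom.Subtype.val (· ∈ A))

theorem chainMap_inclusion_injective (A : Set X) (n : ℕ) :
    Function.Injective (chainMap (inclusion A) n) :=
  Finsupp.mapDomain_injective fun _ _ h =>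
    Subtype.ext (Subtype.val_injective.comp_left (congrArg Subtype.val h))

/-- A chain of `X` lying in `A` is a chain of the induced order, so the order complex of `A` is a
full subcomplex. -/
theorem exists_chainMap_inclusion_eq {A : Set X} {n : ℕ} {c : Chains (orderComplex X) n}
    (hc : c ∈ chainsIn (orderComplex X) A n) : ∃ c', chainMap (inclusion A) n c' = c := by
  refine chainsIn_le_comap LinearMap.id (LinearMap.range (chainMap (inclusion A) n))
    (fun s hs => ?_) hc
  have hchain : IsChain (· ≤ ·) ((↑) ⁻¹' Set.range s.1 : Set A) := fun x hx y hy hxy =>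
    s.isChain hx hy (Subtype.coe_ne_coe.mpr hxy)
  let s' : OrderedSimplex (orderComplex A) n := ⟨fun i => ⟨s.1 i, hs ⟨i, rfl⟩⟩,
    mem_orderComplex_of_range_subset hchain (by rintro _ ⟨i, rfl⟩; exact ⟨i, rfl⟩)⟩
  exact ⟨Finsupp.single s' 1, chainMap_single (inclusion A) s' 1⟩

theorem chainMap_inclusion_mem (A : Set X) (n : ℕ) (c : Chains (orderComplex A) n) :
    chainMap (inclusion A) n c ∈ chainsIn (orderComplex X) A n := by
  have hc : c ∈ chainsIn (orderComplex A) Set.univ n :=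
    (Finsupp.mem_supported ℤ c).mpr fun _ _ => Set.subset_univ _
  refine chainsIn_mono ?_ n ((carried_chainMap (inclusion A) n).mem Set.monotone_image hc)
  rintro _ ⟨x, -, rfl⟩
  exact x.2

/-- Carriers need fillings inside the ambient complex. Injectivity of the inclusion on chains pulls
cycles back to `A`, where they bound. -/
theorem IsAcyclic.acyclicOn {A : Set X} (hA : (orderComplex A).IsAcyclic) :
    AcyclicOn (orderComplex X) A := by
  obtain ⟨⟨x⟩, hA⟩ := hA
  refine ⟨?_, fun n c hc hcycle => ?_⟩
  · refine ⟨_, chainMap_inclusion_mem A 0 (Finsupp.single (vertex x) 1), ?_⟩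
    rw [augmentation_chainMap]
    simp [augmentation]
  · obtain ⟨c, rfl⟩ := exists_chainMap_inclusion_eq hc
    have hc' : c ∈ reducedCycles (orderComplex A) n := by
      cases n with
      | zero => exact (augmentation_chainMap _ c).symm.trans hcycle
      | succ n =>
        refine chainMap_inclusion_injective A n ?_
        rw [← boundary_chainMap, map_zero]
        exact hcycle
    obtain ⟨b, rfl⟩ := Submodule.submoduleOf_eq_top.mp
      (Submodule.Quotient.subsingleton_iff.mp (hA n)) hc'
    exact ⟨_, chainMap_inclusion_mem A _ b, boundary_chainMap _ _ _⟩

theorem OrderedSimplex.exists_lowerClosure_range_eq {n : ℕ}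
    (s : OrderedSimplex (orderComplex X) n) :
    ∃ x, (lowerClosure (Set.range s.1) : Set X) = Set.Iic x := by
  obtain ⟨x, hx, hmax⟩ := s.exists_isGreatest
  refine ⟨x, Set.ext fun z => ⟨?_, fun hz => ⟨x, hx, hz⟩⟩⟩
  rintro ⟨y, hy, hzy⟩
  exact hzy.trans (hmax hy)

end OrderComplex

end AbstractSimplicialComplex

/-! ### The carriers attached to an order-preserving map -/

open AbstractSimplicialComplex in
theorem homologyMap_orderComplexMap_bijective {X Y : Type*} [PartialOrder X] [PartialOrder Y]
    (f : X →o Y) (hf : ∀ y : Y, (orderComplex (f ⁻¹' Set.Iic y)).IsAcyclic) (n : ℕ) :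
    Function.Bijective (homologyMap (orderComplexMap f) n) := by
  -- The lower closure makes sense for every vertex set and is monotone, as a carrier must be, while
  -- giving `Set.Iic y` on simplices.
  let low : Set Y → Set Y := fun S => lowerClosure S
  have hlow : Monotone low := lowerClosure_mono
  have hlowY : ∀ (n : ℕ) (s : OrderedSimplex (orderComplex Y) n),
      AcyclicOn (orderComplex Y) (low (Set.range s.1)) := fun n s => by
    obtain ⟨y, hy⟩ := s.exists_lowerClosure_range_eq
    change AcyclicOn _ (lowerClosure (Set.range s.1) : Set Y)
    rw [hy]
    exact (isAcyclic_orderComplex_of_orderTop (Set.Iic y)).acyclicOn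
  let Φ : Set Y → Set X := fun S => f ⁻¹' low S
  have hΦ : Monotone Φ := fun _ _ h => Set.preimage_mono (hlow h)
  have hΦY : ∀ (n : ℕ) (s : OrderedSimplex (orderComplex Y) n),
      AcyclicOn (orderComplex X) (Φ (Set.range s.1)) := fun n s => by
    obtain ⟨y, hy⟩ := s.exists_lowerClosure_range_eq
    change AcyclicOn _ (f ⁻¹' (lowerClosure (Set.range s.1) : Set Y))
    rw [hy]
    exact (hf y).acyclicOn
  obtain ⟨g, hgΦ, hg₀, hg₁⟩ := exists_carried_chainMap hΦ hΦY
  refine homologyMap_bijective_of_inverse _ g hg₁ ?_ ?_ n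
  · refine sub_mem_range_boundary_of_carried (Φ := Φ ∘ Set.image f)
      (g := fun n => g n ∘ₗ chainMap (orderComplexMap f) n) (h := fun _ => LinearMap.id)
      (hΦ.comp Set.monotone_image) (fun n s => ?_)
      (fun n => (hgΦ n).comp hΦ (carried_chainMap _ n)) (carried_id fun A x hx => ?_)
      (fun c => ?_) (fun _ => rfl) (fun n c => ?_) fun _ _ => rfl
    -- The composite carrier at `s` is `Φ` at the image simplex.
    · have h := hΦY n (s.map (orderComplexMap f))
      rwa [range_map] at h
    · exact subset_lowerClosure ⟨x, hx, rfl⟩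
    · exact (hg₀ _).trans (augmentation_chainMap _ c)
    · simp [hg₁, boundary_chainMap]
  · refine sub_mem_range_boundary_of_carried (Φ := low)
      (g := fun n => chainMap (orderComplexMap f) n ∘ₗ g n) (h := fun _ => LinearMap.id)
      hlow hlowY (fun n => ?_) (carried_id fun A => subset_lowerClosure)
      (fun c => ?_) (fun _ => rfl) (fun n c => ?_) fun _ _ => rfl
    · exact ((carried_chainMap (orderComplexMap f) n).comp Set.monotone_image (hgΦ n)).mono fun A =>
        Set.image_preimage_subset f (low A)
    · exact (augmentation_chainMap _ _).trans (hg₀ c)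
    · simp [hg₁, boundary_chainMap]

theorem corollary5p4 {X Y : Type*} [PartialOrder X] [Finite X] [PartialOrder Y] [Finite Y]
    (f : X →o Y)
    (hf : ∀ y : Y, (AbstractSimplicialComplex.orderComplex (f ⁻¹' Set.Iic y)).IsAcyclic)
    (n : ℕ) :
    Function.Bijective (AbstractSimplicialComplex.homologyMap
      (AbstractSimplicialComplex.orderComplexMap f) n) :=
  homologyMap_orderComplexMap_bijective f hf n
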